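/- Let $\mathcal X,\mathcal Y,\mathcal Z$ be real Hilbert spaces, $f:\mathcal X\to\mathbb R$ and $g:\mathcal Y\to\mathbb R$ convex and continuously differentiable with Lipschitz continuous gradients, $A:\mathcal X\to\mathcal Z$ and $B:\mathcal Y\to\mathcal Z$ continuous linear operators with adjoints $A^\top,B^\top$, and $b\in\mathcal Z$. Norm $\mathcal X\times\mathcal Y$ by $\|(x,y)\|=\sqrt{\|x\|^2+\|y\|^2}$. Let $S$ be the solution set of the problem $$\min_{x\in\mathcal X,\,y\in\mathcal Y} f(x)+g(y)\quad\text{s.t. } Ax+By=b,$$ and assume that its Lagrangian $L(x,y,\lambda)=f(x)+g(y)+\langle\lambda,Ax+By-b\rangle$ has a saddle point, i.e. there is $(x^*,y^*,\lambda^*)$ with $L(x^*,y^*,\lambda)\le L(x^*,y^*,\lambda^*)\le L(x,y,\lambda^*)$ for all $(x,y,\lambda)\in\mathcal X\times\mathcal Y\times\mathcal Z$. Let $t_0>0$, $\delta>0$, $\gamma\in\mathbb R$. Let $\beta:[t_0,\infty)\to(0,\infty)$ be continuously differentiable and non-decreasing, and let $\epsilon:[t_0,\infty)\to[0,\infty)$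 be continuously differentiable and non-increasing with $\lim_{t\to\infty}\epsilon(t)=0$. Suppose that $$\int_{t_0}^{\infty}\epsilon(t)\,dt<\infty,\qquad \lim_{t\to\infty}\beta(t)\epsilon(t)=\infty,\qquad \dot\beta(t)\le\tfrac1\delta\beta(t)\ \ (t\ge t_0),\qquad \tfrac1\delta<\gamma.$$ Let $(\bar x^*,\bar y^*)=\mathrm{proj}_S\,0$ be the element of minimal norm of $S$, and let $(x,y,\lambda):[t_0,\infty)\to\mathcal X\times\mathcal Y\times\mathcal Z$, with $x,y$ twice differentiable and $\lambda$ differentiable, satisfy for all $t\ge t_0$ (derivatives at $t_0$ being one-sided) $$\begin{cases}\ddot x(t)+\gamma\dot x(t)+\beta(t)\big(\nabla f(x(t))+A^\top\lambda(t)+A^\top(Ax(t)+By(t)-b)+\epsilon(t)x(t)\big)=0,\\ \ddot y(t)+\gamma\dot y(t)+\beta(t)\big(\nabla g(y(t))+B^\top\lambda(t)+B^\top(Ax(t)+By(t)-b)+\epsilon(t)y(t)\big)=0,\\ \dot\lambda(t)-\beta(t)\big(A(x(t)+\delta\dot x(t))+B(y(t)+\delta\dot y(t))-b\big)=0.\end{cases}$$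 Then $$\liminf_{t\to\infty}\|(x(t),y(t))-(\bar x^*,\bar y^*)\|=0.$$ If, in addition, there is $T\ge t_0$ such that the trajectory $\{(x(t),y(t)):t\ge T\}$ stays either in the closed ball of radius $\|(\bar x^*,\bar y^*)\|$ centered at $0$ or in its complement, then $$\lim_{t\to\infty}\|(x(t),y(t))-(\bar x^*,\bar y^*)\|=0.$$ -/

import Mathlib

open Filter Topology

noncomputable section

/-- Data of the separable problem `min f x + g y` subject to `A x + B y = b`. -/
structure SepProblem (X Y Z : Type*)
    [NormedAddCommGroup X] [InnerProductSpace ℝ X]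
    [NormedAddCommGroup Y] [InnerProductSpace ℝ Y]
    [NormedAddCommGroup Z] [InnerProductSpace ℝ Z] where
  f : X → ℝ
  g : Y → ℝ
  A : X →L[ℝ] Z
  B : Y →L[ℝ] Z
  b : Z

namespace SepProblem

variable {X Y Z : Type*}
  [NormedAddCommGroup X] [InnerProductSpace ℝ X]
  [NormedAddCommGroup Y] [InnerProductSpace ℝ Y]
  [NormedAddCommGroup Z] [InnerProductSpace ℝ Z]

/-- The residual `A x + B y - b` of the linear constraint. -/
def residual (P : SepProblem X Y Z) (x : X) (y : Y) : Z := P.A x + P.B y - P.b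

/-- The objective function `Φ(x, y) = f x + g y`. -/
def objective (P : SepProblem X Y Z) (x : X) (y : Y) : ℝ := P.f x + P.g y

/-- The Lagrangian `L(x, y, l) = f x + g y + ⟨l, A x + B y - b⟩`. -/
def lagrangian (P : SepProblem X Y Z) (x : X) (y : Y) (l : Z) : ℝ :=
  P.f x + P.g y + inner ℝ l (P.residual x y)

/-- `(x, y, l)` is a saddle point of the Lagrangian. -/
def IsSaddlePoint (P : SepProblem X Y Z) (x : X) (y : Y) (l : Z) : Prop :=
  ∀ (x' : X) (y' : Y) (l' : Z),
    P.lagrangian x y l' ≤ P.lagrangian x y l ∧ P.lagrangian x y l ≤ P.lagrangian x' y' l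

/-- The solution set of the problem, in the Hilbert product `WithLp 2 (X × Y)`, whose norm is
`‖(x, y)‖ = √(‖x‖ ^ 2 + ‖y‖ ^ 2)`. -/
def solutionSet (P : SepProblem X Y Z) : Set (WithLp 2 (X × Y)) :=
  {z | P.residual z.fst z.snd = 0 ∧
    ∀ (x : X) (y : Y), P.residual x y = 0 → P.objective z.fst z.snd ≤ P.objective x y}

/-- `(x, y, l) : [t₀, ∞) → X × Y × Z` is a (classical, global) solution of
```
x'' + γ x' + β(t) (∇f(x) + Aᵀ l + Aᵀ (A x + B y - b) + ε(t) x) = 0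
y'' + γ y' + β(t) (∇g(y) + Bᵀ l + Bᵀ (A x + B y - b) + ε(t) y) = 0
l' - β(t) (A (x + δ x') + B (y + δ y') - b) = 0
```
on `[t₀, ∞)`, with one-sided derivatives at `t₀`. -/
def IsSolution [CompleteSpace X] [CompleteSpace Y] [CompleteSpace Z]
    (P : SepProblem X Y Z) (γ δ t₀ : ℝ) (β ε : ℝ → ℝ)
    (x : ℝ → X) (y : ℝ → Y) (l : ℝ → Z) : Prop :=
  ∃ (x' x'' : ℝ → X) (y' y'' : ℝ → Y) (l' : ℝ → Z), ∀ t ∈ Set.Ici t₀,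
    HasDerivWithinAt x (x' t) (Set.Ici t₀) t ∧
    HasDerivWithinAt x' (x'' t) (Set.Ici t₀) t ∧
    HasDerivWithinAt y (y' t) (Set.Ici t₀) t ∧
    HasDerivWithinAt y' (y'' t) (Set.Ici t₀) t ∧
    HasDerivWithinAt l (l' t) (Set.Ici t₀) t ∧
    x'' t + γ • x' t + β t • (gradient P.f (x t) + P.A.adjoint (l t)
      + P.A.adjoint (P.residual (x t) (y t)) + ε t • x t) = 0 ∧
    y'' t + γ • y' t + β t • (gradient P.g (y t) + P.B.adjoint (l t)
      + P.B.adjoint (P.residual (x t) (y t)) + ε t • y t) = 0 ∧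
    l' t - β t • P.residual (x t + δ • x' t) (y t + δ • y' t) = 0

end SepProblem

/-- `p` is a metric projection of `z` onto `S`: a point of `S` closest to `z`. -/
def IsProjOnto {E : Type*} [PseudoMetricSpace E] (S : Set E) (z p : E) : Prop :=
  p ∈ S ∧ ∀ w ∈ S, dist z p ≤ dist z w

end

/-! In the Hilbert product put `z = (x, y)`, `K z = A x + B y`, `p = proj_S 0`, and let `φ` be the
augmented Lagrangian at a dual optimal multiplier `ls`, minus the optimal value. Then `φ` is convex
and nonnegative, and its zero of least norm is `p`. With `μ = l - ls` the system becomes a damped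
equation for `z` coupled to `μ` through `K`.

Up to a bound on its derivative, one Lyapunov function with a free constant `c` does everything.
With `c = 0`, integrability of `ε` and `β → ∞` give `φ (z t) → 0` (`tendsto_apply`). With `c = ‖p‖²`
it decreases while `z` stays outside the ball of radius `‖p‖`, so `β ε (‖z‖² - ‖p‖²)` is bounded and
`β ε → ∞` forces `limsup ‖z‖ ≤ ‖p‖` (`tendsto_of_le_norm`); inside the ball this bound is free. In
both cases `tendsto_of_convex_of_norm_le` yields strong convergence. A general trajectory either
visits the ball at arbitrarily late times or finally leaves it, whence the liminf. -/

/-! ### Convex functions and their least norm zeros -/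

/-- The first order characterization of convexity. -/
theorem ConvexOn.inner_le_sub_of_hasGradientAt {H : Type*} [NormedAddCommGroup H]
    [InnerProductSpace ℝ H] [CompleteSpace H] {φ : H → ℝ} (hφ : ConvexOn ℝ Set.univ φ)
    {G w : H} (hG : HasGradientAt φ G w) (u : H) :
    inner ℝ G (u - w) ≤ φ u - φ w := by
  have h1 : ConvexOn ℝ Set.univ (fun s : ℝ => φ (AffineMap.lineMap w u s)) := by
    simpa [Function.comp_def] using hφ.comp_affineMap (AffineMap.lineMap (k := ℝ) w u)
  have h2 : HasDerivAt (fun s : ℝ => φ (AffineMap.lineMap w u s)) (inner ℝ G (u - w)) 0 := by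
    have h3 : HasDerivAt (fun s : ℝ => AffineMap.lineMap w u s) (u - w) 0 :=
      AffineMap.hasDerivAt_lineMap
    have h4 : HasFDerivAt φ (InnerProductSpace.toDual ℝ H G)
        ((fun s : ℝ => AffineMap.lineMap w u s) 0) := by
      simpa using hG.hasFDerivAt
    exact h4.comp_hasDerivAt (0 : ℝ) h3
  have h5 := h1.le_slope_of_hasDerivAt (Set.mem_univ 0) (Set.mem_univ 1) one_pos h2
  simpa [slope_def_field] using h5

/-- Well-posedness of the least norm zero of a nonnegative convex function: minimizing families
whose norms asymptotically do not exceed the least norm converge strongly. -/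
theorem tendsto_of_convex_of_norm_le {H ι : Type*} [NormedAddCommGroup H] [InnerProductSpace ℝ H]
    [CompleteSpace H] {φ : H → ℝ} (hφ : ConvexOn ℝ Set.univ φ) (hcont : Continuous φ)
    (hnonneg : ∀ w, 0 ≤ φ w) {p : H} (hp : φ p = 0) (hmin : ∀ w, φ w = 0 → ‖p‖ ≤ ‖w‖)
    {l : Filter ι} {u : ι → H} (hu : Tendsto (fun i => φ (u i)) l (𝓝 0))
    (hnorm : ∀ η > 0, ∀ᶠ i in l, ‖u i‖ ^ 2 ≤ ‖p‖ ^ 2 + η) :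
    Tendsto u l (𝓝 p) := by
  -- `q n` is the projection of 0 onto a sublevel set; the estimate is its variational inequality.
  -- It makes `q` Cauchy, since `‖q n‖²` increases and is bounded by `‖p‖²`, so no weak compactness
  -- is needed.
  have hproj : ∀ n : ℕ, ∃ q : H, φ q ≤ 1 / ((n : ℝ) + 1) ∧
      ∀ w, φ w ≤ 1 / ((n : ℝ) + 1) → ‖w - q‖ ^ 2 ≤ ‖w‖ ^ 2 - ‖q‖ ^ 2 := by
    intro n
    set C : Set H := {w | φ w ≤ 1 / ((n : ℝ) + 1)}
    have hne : C.Nonempty := ⟨p, by simp only [C, Set.mem_ofPred_eq, hp]; positivity⟩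
    have hclosed : IsClosed C := isClosed_le hcont continuous_const
    have hconv : Convex ℝ C := by simpa [C] using hφ.convex_le (1 / ((n : ℝ) + 1))
    obtain ⟨q, hq, hq'⟩ := exists_norm_eq_iInf_of_complete_convex hne hclosed.isComplete hconv 0
    refine ⟨q, hq, fun w hw => ?_⟩
    have h := (norm_eq_iInf_iff_real_inner_le_zero hconv hq).1 hq' w hw
    rw [zero_sub, inner_neg_left, inner_sub_right, real_inner_self_eq_norm_sq] at h
    rw [norm_sub_sq_real, real_inner_comm]
    linarith
  choose q hq hqw using hproj
  have hanti : ∀ m n : ℕ, n ≤ m → 1 / ((m : ℝ) + 1) ≤ 1 / ((n : ℝ) + 1) := fun m n h =>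
    one_div_le_one_div_of_le (by positivity) (by exact_mod_cast Nat.succ_le_succ h)
  have hpq : ∀ n, ‖p - q n‖ ^ 2 ≤ ‖p‖ ^ 2 - ‖q n‖ ^ 2 := fun n =>
    hqw n p (by rw [hp]; positivity)
  have hmono : Monotone fun n => ‖q n‖ ^ 2 := fun n m h => by
    have := hqw n (q m) ((hq m).trans (hanti m n h))
    have h0 := sq_nonneg ‖q m - q n‖
    simp only
    linarith
  have hbdd : BddAbove (Set.range fun n => ‖q n‖ ^ 2) := ⟨‖p‖ ^ 2, by
    rintro _ ⟨n, rfl⟩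
    have := hpq n
    have h0 := sq_nonneg ‖p - q n‖
    simp only
    linarith⟩
  have hlim := tendsto_atTop_ciSup hmono hbdd
  set M := ⨆ n, ‖q n‖ ^ 2
  have hle : ∀ n, ‖q n‖ ^ 2 ≤ M := fun n => le_ciSup hbdd n
  have hsqrt : Tendsto (fun n => √(M - ‖q n‖ ^ 2)) atTop (𝓝 0) := by
    have h := (tendsto_const_nhds.sub hlim : Tendsto (fun n => M - ‖q n‖ ^ 2) atTop (𝓝 (M - M)))
    simpa using h.sqrt
  have hcau : CauchySeq q := cauchySeq_of_le_tendsto_0' _ (fun n m h => by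
    rw [dist_comm, dist_eq_norm]
    refine Real.le_sqrt_of_sq_le ?_
    have := hqw n (q m) ((hq m).trans (hanti m n h))
    linarith [hle m]) hsqrt
  obtain ⟨r, hr⟩ := cauchySeq_tendsto_of_complete hcau
  have hr0 : φ r = 0 := by
    refine le_antisymm ?_ (hnonneg r)
    exact le_of_tendsto_of_tendsto' ((hcont.tendsto r).comp hr)
      tendsto_one_div_add_atTop_nhds_zero_nat hq
  have hpr : ‖p - r‖ ^ 2 ≤ ‖p‖ ^ 2 - ‖r‖ ^ 2 :=
    le_of_tendsto_of_tendsto' ((tendsto_const_nhds.sub hr).norm.pow 2)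
      (tendsto_const_nhds.sub (hr.norm.pow 2)) hpq
  have hrp : r = p := by
    have h1 : ‖p‖ ^ 2 ≤ ‖r‖ ^ 2 := pow_le_pow_left₀ (norm_nonneg _) (hmin r hr0) 2
    have h2 : ‖p - r‖ = 0 := by
      have h0 := sq_nonneg ‖p - r‖
      exact pow_eq_zero_iff (two_ne_zero) |>.1 (le_antisymm (by linarith) h0)
    exact (sub_eq_zero.1 (norm_eq_zero.1 h2)).symm
  subst hrp
  rw [Metric.tendsto_nhds]
  intro η hη
  -- The margins satisfy `η² / 8 + η² / 16 < (η / 2)²`, which bounds `‖u i - q n‖` by `η / 2`.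
  have hN : ∀ᶠ n in atTop, dist (q n) r < η / 2 ∧ ‖r‖ ^ 2 - η ^ 2 / 8 < ‖q n‖ ^ 2 :=
    (Metric.tendsto_nhds.1 hr _ (by positivity)).and
      ((hr.norm.pow 2).eventually_const_lt (by linarith [sq_pos_of_pos hη]))
  obtain ⟨n, hn1, hn2⟩ := hN.exists
  filter_upwards [hu.eventually_le_const (show (0 : ℝ) < 1 / ((n : ℝ) + 1) by positivity),
    hnorm (η ^ 2 / 16) (by positivity)] with i hi1 hi2
  have h1 := hqw n (u i) hi1
  have h2 : ‖u i - q n‖ < η / 2 := by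
    refine lt_of_pow_lt_pow_left₀ 2 (by positivity) ?_
    have := sq_pos_of_pos hη
    nlinarith
  calc dist (u i) r ≤ dist (u i) (q n) + dist (q n) r := dist_triangle _ _ _
    _ < η / 2 + η / 2 := by rw [dist_eq_norm (u i)]; exact add_lt_add h2 hn1
    _ = η := by ring

/-! ### Lyapunov analysis of the dynamics -/

section Dynamics

variable {H Z : Type*} [NormedAddCommGroup H] [InnerProductSpace ℝ H] [CompleteSpace H]
  [NormedAddCommGroup Z] [InnerProductSpace ℝ Z] [CompleteSpace Z]

/-- The Lyapunov function of the Tikhonov regularized primal-dual dynamics. -/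
noncomputable def tikhonovEnergy (φ : H → ℝ) (p : H) (δ γ c β ε : ℝ) (z v : H) (μ : Z) : ℝ :=
  δ ^ 2 * (β * (φ z + ε / 2 * (‖z‖ ^ 2 - c))) + 1 / 2 * ‖z - p + δ • v‖ ^ 2
    + (δ * γ - 1) / 2 * ‖z - p‖ ^ 2 + δ / 2 * ‖μ‖ ^ 2

/-- The weights in the energy are chosen so that every cross term cancels: `⟨z - p, v⟩` by the
factor `δ γ - 1`, `⟨G + ε z, v⟩` by the factor `δ²`, and the coupling through `K` by the `μ` term,
thanks to the extrapolation `z + δ v` in the dual equation. -/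
theorem hasDerivAt_tikhonovEnergy {φ : H → ℝ} {p : H} {K : H →L[ℝ] Z} {δ γ : ℝ} (c : ℝ)
    {β ε : ℝ → ℝ} {z v : ℝ → H} {μ : ℝ → Z} {t β' ε' : ℝ} {G a : H} {m : Z}
    (hG : HasGradientAt φ G (z t))
    (hβ : HasDerivAt β β' t) (hε : HasDerivAt ε ε' t)
    (hz : HasDerivAt z (v t) t) (hv : HasDerivAt v a t) (hμ : HasDerivAt μ m t)
    (ha : a + γ • v t + β t • (G + K.adjoint (μ t) + ε t • z t) = 0)
    (hm : m = β t • K (z t - p + δ • v t)) :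
    HasDerivAt (fun s => tikhonovEnergy φ p δ γ c (β s) (ε s) (z s) (v s) (μ s))
      (-(δ * (δ * γ - 1)) * ‖v t‖ ^ 2 - δ * β t * inner ℝ (G + ε t • z t) (z t - p)
        + δ ^ 2 * (β' * (φ (z t) + ε t / 2 * (‖z t‖ ^ 2 - c))
          + β t * (ε' / 2 * (‖z t‖ ^ 2 - c)))) t := by
  have h1 : HasDerivAt (fun s => φ (z s)) (inner ℝ G (v t)) t :=
    hG.hasFDerivAt.comp_hasDerivAt t hz
  have h2 := hz.norm_sq
  have h3 := ((hz.sub_const p).add (hv.const_smul δ)).norm_sq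
  have h4 := (hz.sub_const p).norm_sq
  have h5 := hμ.norm_sq
  have h6 := ((((hβ.mul (h1.add ((hε.div_const 2).mul (h2.sub_const c)))).const_mul (δ ^ 2)).add
    (h3.const_mul (1 / 2))).add (h4.const_mul ((δ * γ - 1) / 2))).add (h5.const_mul (δ / 2))
  refine h6.congr_deriv ?_
  obtain rfl : a = -(γ • v t) - β t • (G + K.adjoint (μ t) + ε t • z t) := by
    rw [← sub_eq_zero, ← ha]; abel
  subst hm
  have h7 : inner ℝ (v t) (K.adjoint (μ t)) = inner ℝ (μ t) (K (v t)) := by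
    rw [real_inner_comm, ContinuousLinearMap.adjoint_inner_left]
  have h8 : inner ℝ (z t - p) (K.adjoint (μ t)) = inner ℝ (μ t) (K (z t - p)) := by
    rw [real_inner_comm, ContinuousLinearMap.adjoint_inner_left]
  have h9 : inner ℝ (z t - p) (v t) = inner ℝ (v t) (z t - p) := real_inner_comm _ _
  have h10 : inner ℝ G (v t) = inner ℝ (v t) G := real_inner_comm _ _
  have h11 : inner ℝ (z t) (v t) = inner ℝ (v t) (z t) := real_inner_comm _ _
  have h12 : inner ℝ (G + ε t • z t) (z t - p)
      = inner ℝ (z t - p) G + ε t * inner ℝ (z t - p) (z t) := by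
    rw [real_inner_comm, inner_add_right, inner_smul_right]
  rw [h12]
  simp only [Pi.add_apply, Pi.smul_apply, Pi.mul_apply, inner_add_left, inner_add_right,
    inner_sub_right, inner_neg_right, inner_smul_left, inner_smul_right, real_inner_self_eq_norm_sq, map_add, map_smul,
    RCLike.conj_to_real, smul_add, smul_sub, smul_neg, h7, h8, h9, h10, h11]
  ring

/-- Convexity bounds `⟨G + ε w, w - p⟩` below by `φ w + ε / 2 * (‖w‖² - ‖p‖²)`. The growth condition
`δ β' ≤ β` lets the resulting `-δ β φ` absorb `δ² β' φ`, and `δ γ > 1` makes the velocity term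
dissipative. -/
theorem hasDerivAt_tikhonovEnergy_le {φ : H → ℝ} (hφ : ConvexOn ℝ Set.univ φ)
    (hnonneg : ∀ w, 0 ≤ φ w) {p : H} (hp : φ p = 0) {G : H} {w v : H} (hG : HasGradientAt φ G w)
    {δ γ c β β' ε ε' : ℝ} (hδ : 0 < δ) (hγ : 1 / δ < γ) (hβ : 0 ≤ β) (hβ' : β' ≤ 1 / δ * β)
    (hε : 0 ≤ ε) :
    -(δ * (δ * γ - 1)) * ‖v‖ ^ 2 - δ * β * inner ℝ (G + ε • w) (w - p)
        + δ ^ 2 * (β' * (φ w + ε / 2 * (‖w‖ ^ 2 - c)) + β * (ε' / 2 * (‖w‖ ^ 2 - c)))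
      ≤ δ ^ 2 * β' * (ε / 2) * (‖w‖ ^ 2 - c) + δ ^ 2 * β * (ε' / 2) * (‖w‖ ^ 2 - c)
        - δ * β * (ε / 2) * (‖w‖ ^ 2 - ‖p‖ ^ 2) := by
  have h1 : 0 ≤ δ * γ - 1 := by
    rw [div_lt_iff₀ hδ] at hγ; linarith
  have h2 : 0 ≤ δ * (δ * γ - 1) * ‖v‖ ^ 2 := by positivity
  have h3 : φ w ≤ inner ℝ G (w - p) := by
    have := hφ.inner_le_sub_of_hasGradientAt hG p
    rw [← neg_sub w p, inner_neg_right, hp] at this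
    linarith
  have h4 : 1 / 2 * (‖w‖ ^ 2 - ‖p‖ ^ 2) ≤ inner ℝ w (w - p) := by
    have := norm_sub_sq_real w p
    rw [inner_sub_right, real_inner_self_eq_norm_sq]
    nlinarith [sq_nonneg ‖w - p‖]
  have h5 : δ * β' ≤ β := by
    rw [div_mul_eq_mul_div, le_div_iff₀ hδ] at hβ'; linarith
  have h6 : φ w + ε / 2 * (‖w‖ ^ 2 - ‖p‖ ^ 2) ≤ inner ℝ (G + ε • w) (w - p) := by
    rw [inner_add_left, inner_smul_left, RCLike.conj_to_real]
    linarith [mul_le_mul_of_nonneg_left h4 hε]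
  have h7 := mul_le_mul_of_nonneg_left h6 (mul_nonneg hδ.le hβ)
  have h8 : 0 ≤ δ * (β - δ * β') * φ w :=
    mul_nonneg (mul_nonneg hδ.le (by linarith)) (hnonneg w)
  linarith

/-- Trajectories, on `(t₀, ∞)`, of the Tikhonov regularized primal-dual dynamics with vanishing
regularization, centered at a zero `p` of the nonnegative convex function `φ`. -/
structure IsTikhonovTrajectory (φ : H → ℝ) (G : H → H) (p : H) (K : H →L[ℝ] Z) (δ γ t₀ : ℝ)
    (β β' ε ε' : ℝ → ℝ) (z v a : ℝ → H) (μ m : ℝ → Z) : Prop where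
  convexOn : ConvexOn ℝ Set.univ φ
  nonneg : ∀ w, 0 ≤ φ w
  apply_eq_zero : φ p = 0
  hasGradientAt : ∀ w, HasGradientAt φ (G w) w
  delta_pos : 0 < δ
  lt_gamma : 1 / δ < γ
  beta_pos : ∀ t > t₀, 0 < β t
  beta_mono : MonotoneOn β (Set.Ioi t₀)
  beta_deriv : ∀ t > t₀, HasDerivAt β (β' t) t
  beta_deriv_le : ∀ t > t₀, β' t ≤ 1 / δ * β t
  eps_nonneg : ∀ t > t₀, 0 ≤ ε t
  eps_deriv : ∀ t > t₀, HasDerivAt ε (ε' t) t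
  eps_deriv_nonpos : ∀ t > t₀, ε' t ≤ 0
  deriv_z : ∀ t > t₀, HasDerivAt z (v t) t
  deriv_v : ∀ t > t₀, HasDerivAt v (a t) t
  deriv_mu : ∀ t > t₀, HasDerivAt μ (m t) t
  primal : ∀ t > t₀, a t + γ • v t + β t • (G (z t) + K.adjoint (μ t) + ε t • z t) = 0
  dual : ∀ t > t₀, m t = β t • K (z t - p + δ • v t)

namespace IsTikhonovTrajectory

variable {φ : H → ℝ} {G : H → H} {p : H} {K : H →L[ℝ] Z} {δ γ t₀ : ℝ}
    {β β' ε ε' : ℝ → ℝ} {z v a : ℝ → H} {μ m : ℝ → Z}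

theorem le_tikhonovEnergy (h : IsTikhonovTrajectory φ G p K δ γ t₀ β β' ε ε' z v a μ m)
    (c t : ℝ) :
    δ ^ 2 * (β t * (φ (z t) + ε t / 2 * (‖z t‖ ^ 2 - c)))
      ≤ tikhonovEnergy φ p δ γ c (β t) (ε t) (z t) (v t) (μ t) := by
  have h1 : 0 ≤ δ * γ - 1 := by
    have := h.lt_gamma
    rw [div_lt_iff₀ h.delta_pos] at this; linarith
  have h2 := h.delta_pos
  have h3 : 0 ≤ 1 / 2 * ‖z t - p + δ • v t‖ ^ 2 + (δ * γ - 1) / 2 * ‖z t - p‖ ^ 2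
      + δ / 2 * ‖μ t‖ ^ 2 := by positivity
  rw [tikhonovEnergy]
  linarith

theorem exists_hasDerivAt_le (h : IsTikhonovTrajectory φ G p K δ γ t₀ β β' ε ε' z v a μ m)
    (c : ℝ) {t : ℝ} (ht : t₀ < t) :
    ∃ D, HasDerivAt (fun s => tikhonovEnergy φ p δ γ c (β s) (ε s) (z s) (v s) (μ s)) D t ∧
      D ≤ δ ^ 2 * β' t * (ε t / 2) * (‖z t‖ ^ 2 - c)
        + δ ^ 2 * β t * (ε' t / 2) * (‖z t‖ ^ 2 - c)
        - δ * β t * (ε t / 2) * (‖z t‖ ^ 2 - ‖p‖ ^ 2) :=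
  ⟨_, hasDerivAt_tikhonovEnergy c (h.hasGradientAt (z t)) (h.beta_deriv t ht) (h.eps_deriv t ht)
    (h.deriv_z t ht) (h.deriv_v t ht) (h.deriv_mu t ht) (h.primal t ht) (h.dual t ht),
    hasDerivAt_tikhonovEnergy_le h.convexOn h.nonneg h.apply_eq_zero (h.hasGradientAt _)
      h.delta_pos h.lt_gamma (h.beta_pos t ht).le (h.beta_deriv_le t ht) (h.eps_nonneg t ht)⟩

/-- Outside the ball of radius `‖p‖` the regularized gap decays like `1 / β`. -/
theorem exists_bound_of_norm_le (h : IsTikhonovTrajectory φ G p K δ γ t₀ β β' ε ε' z v a μ m)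
    {T : ℝ} (hT : t₀ < T) (hout : ∀ t ≥ T, ‖p‖ ≤ ‖z t‖) :
    ∃ C ≥ 0, ∀ t ≥ T, β t * (φ (z t) + ε t / 2 * (‖z t‖ ^ 2 - ‖p‖ ^ 2)) ≤ C := by
  set E := fun s => tikhonovEnergy φ p δ γ (‖p‖ ^ 2) (β s) (ε s) (z s) (v s) (μ s) with hE
  have hδ := h.delta_pos
  have hanti : AntitoneOn E (Set.Ici T) := by
    refine antitoneOn_of_deriv_nonpos (convex_Ici T) (fun t ht => ?_) (fun t ht => ?_)
      (fun t ht => ?_)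
    · obtain ⟨D, hD, -⟩ := h.exists_hasDerivAt_le (‖p‖ ^ 2) (hT.trans_le ht)
      exact hD.continuousAt.continuousWithinAt
    · obtain ⟨D, hD, -⟩ := h.exists_hasDerivAt_le (‖p‖ ^ 2) (hT.trans_le (interior_subset ht))
      exact hD.differentiableAt.differentiableWithinAt
    · have htT : t ≥ T := interior_subset ht
      have ht0 := hT.trans_le htT
      obtain ⟨D, hD, hle⟩ := h.exists_hasDerivAt_le (‖p‖ ^ 2) ht0
      rw [hD.deriv]
      refine hle.trans ?_
      have h1 : 0 ≤ ‖z t‖ ^ 2 - ‖p‖ ^ 2 :=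
        sub_nonneg.2 (pow_le_pow_left₀ (norm_nonneg _) (hout t htT) 2)
      have h2 : δ * β' t ≤ β t := by
        have := h.beta_deriv_le t ht0
        rw [div_mul_eq_mul_div, le_div_iff₀ hδ] at this; linarith
      -- With `c = ‖p‖²` the derivative bound is exactly minus the sum of `h3` and `h4`.
      have h3 : 0 ≤ (β t - δ * β' t) * (δ * (ε t / 2) * (‖z t‖ ^ 2 - ‖p‖ ^ 2)) :=
        mul_nonneg (by linarith)
          (mul_nonneg (mul_nonneg hδ.le (by linarith [h.eps_nonneg t ht0])) h1)
      have h4 : 0 ≤ δ ^ 2 * β t * (-ε' t / 2) * (‖z t‖ ^ 2 - ‖p‖ ^ 2) :=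
        mul_nonneg (mul_nonneg (mul_nonneg (sq_nonneg δ) (h.beta_pos t ht0).le)
          (by linarith [h.eps_deriv_nonpos t ht0])) h1
      linarith
  refine ⟨|E T| / δ ^ 2, by positivity, fun t ht => ?_⟩
  rw [le_div_iff₀ (by positivity), mul_comm]
  exact (h.le_tikhonovEnergy (‖p‖ ^ 2) t).trans
    ((hanti Set.self_mem_Ici ht ht).trans (le_abs_self _))

/-- With `c = 0` the only positive part of the derivative bound is `δ / 2 * ‖p‖² β ε`. Since `β u ≤
β t` on `[s, t]`, its integral is at most `δ / 2 * ‖p‖² β t` times that of `ε`. -/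
theorem mul_apply_le (h : IsTikhonovTrajectory φ G p K δ γ t₀ β β' ε ε' z v a μ m)
    {J : ℝ → ℝ} (hJ : ∀ t > t₀, HasDerivAt J (ε t) t) {s t : ℝ} (hs : t₀ < s) (hst : s ≤ t) :
    δ ^ 2 * (β t * φ (z t)) ≤ tikhonovEnergy φ p δ γ 0 (β s) (ε s) (z s) (v s) (μ s)
      + δ / 2 * ‖p‖ ^ 2 * β t * (J t - J s) := by
  set E := fun s => tikhonovEnergy φ p δ γ 0 (β s) (ε s) (z s) (v s) (μ s) with hE
  have hδ := h.delta_pos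
  have hderiv : ∀ u ∈ Set.Icc s t, ∃ D ≤ 0,
      HasDerivAt (fun u => E u - δ / 2 * ‖p‖ ^ 2 * β t * J u) D u := by
    intro u hu
    have hu0 : t₀ < u := hs.trans_le hu.1
    obtain ⟨D, hD, hle⟩ := h.exists_hasDerivAt_le 0 hu0
    refine ⟨_, ?_, hD.sub ((hJ u hu0).const_mul (δ / 2 * ‖p‖ ^ 2 * β t))⟩
    have h2 : δ * β' u ≤ β u := by
      have := h.beta_deriv_le u hu0
      rw [div_mul_eq_mul_div, le_div_iff₀ hδ] at this; linarith
    have h5 := h.eps_nonneg u hu0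
    have h3 : 0 ≤ (β u - δ * β' u) * (δ * (ε u / 2) * ‖z u‖ ^ 2) :=
      mul_nonneg (by linarith) (by positivity)
    have h4 : 0 ≤ δ ^ 2 * β u * (-ε' u / 2) * ‖z u‖ ^ 2 :=
      mul_nonneg (mul_nonneg (mul_nonneg (sq_nonneg δ) (h.beta_pos u hu0).le)
        (by linarith [h.eps_deriv_nonpos u hu0])) (sq_nonneg _)
    have h6 : 0 ≤ (β t - β u) * (δ / 2 * ‖p‖ ^ 2 * ε u) :=
      mul_nonneg (sub_nonneg.2 (h.beta_mono hu0 (hs.trans_le hst) hu.2)) (by positivity)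
    linarith
  have hanti : AntitoneOn (fun u => E u - δ / 2 * ‖p‖ ^ 2 * β t * J u) (Set.Icc s t) := by
    refine antitoneOn_of_deriv_nonpos (convex_Icc s t) (fun u hu => ?_) (fun u hu => ?_)
      (fun u hu => ?_)
    · obtain ⟨D, -, hD⟩ := hderiv u hu
      exact hD.continuousAt.continuousWithinAt
    · obtain ⟨D, -, hD⟩ := hderiv u (interior_subset hu)
      exact hD.differentiableAt.differentiableWithinAt
    · obtain ⟨D, h0, hD⟩ := hderiv u (interior_subset hu)
      rw [hD.deriv]
      exact h0
  have h1 := hanti (Set.left_mem_Icc.2 hst) (Set.right_mem_Icc.2 hst) hst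
  have h2 := h.le_tikhonovEnergy 0 t
  have ht0 : t₀ < t := hs.trans_le hst
  have h3 : 0 ≤ δ ^ 2 * (β t * (ε t / 2 * ‖z t‖ ^ 2)) :=
    mul_nonneg (sq_nonneg _) (mul_nonneg (h.beta_pos t ht0).le
      (mul_nonneg (by linarith [h.eps_nonneg t ht0]) (sq_nonneg _)))
  simp only [hE] at h1
  linarith

/-- After division by `β t`, letting `t → ∞` leaves a multiple of the tail `j - J s`, which is small
for large `s`. -/
theorem tendsto_apply (h : IsTikhonovTrajectory φ G p K δ γ t₀ β β' ε ε' z v a μ m)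
    {J : ℝ → ℝ} (hJ : ∀ t > t₀, HasDerivAt J (ε t) t) {j : ℝ} (hJlim : Tendsto J atTop (𝓝 j))
    (hβ : Tendsto β atTop atTop) :
    Tendsto (fun t => φ (z t)) atTop (𝓝 0) := by
  have hδ := h.delta_pos
  rw [Metric.tendsto_nhds]
  intro η hη
  have hbd : ∀ s > t₀, ∀ t ≥ s, φ (z t) ≤
      tikhonovEnergy φ p δ γ 0 (β s) (ε s) (z s) (v s) (μ s) / δ ^ 2 * (β t)⁻¹
      + ‖p‖ ^ 2 / (2 * δ) * (J t - J s) := by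
    intro s hs t hst
    have hβt := h.beta_pos t (hs.trans_le hst)
    have h1 := h.mul_apply_le hJ hs hst
    rw [← mul_le_mul_iff_right₀ (show 0 < δ ^ 2 * β t by positivity)]
    refine (le_of_eq (mul_assoc _ _ _)).trans (h1.trans (le_of_eq ?_))
    field_simp
  have hs : ∀ᶠ s in atTop, t₀ < s ∧ ‖p‖ ^ 2 / (2 * δ) * (j - J s) < η := by
    refine (eventually_gt_atTop t₀).and ?_
    have h1 : Tendsto (fun s => ‖p‖ ^ 2 / (2 * δ) * (j - J s)) atTop
        (𝓝 (‖p‖ ^ 2 / (2 * δ) * (j - j))) := (tendsto_const_nhds.sub hJlim).const_mul _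
    rw [sub_self, mul_zero] at h1
    exact h1.eventually_lt_const hη
  obtain ⟨s, hs0, hs1⟩ := hs.exists
  have hlim : Tendsto (fun t =>
      tikhonovEnergy φ p δ γ 0 (β s) (ε s) (z s) (v s) (μ s) / δ ^ 2 * (β t)⁻¹
      + ‖p‖ ^ 2 / (2 * δ) * (J t - J s)) atTop (𝓝 (‖p‖ ^ 2 / (2 * δ) * (j - J s))) := by
    have h1 := (hβ.inv_tendsto_atTop.const_mul
      (tikhonovEnergy φ p δ γ 0 (β s) (ε s) (z s) (v s) (μ s) / δ ^ 2)).add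
      ((hJlim.sub_const (J s)).const_mul (‖p‖ ^ 2 / (2 * δ)))
    simpa using h1
  filter_upwards [hlim.eventually_lt_const hs1, eventually_ge_atTop s] with t ht hst
  rw [Real.dist_eq, sub_zero, abs_of_nonneg (h.nonneg _)]
  exact (hbd s hs0 t hst).trans_lt ht

/-- The filter `l` is left free so as to cover both `atTop` and its restriction to the times spent
in the ball. -/
theorem tendsto_of_norm_le (h : IsTikhonovTrajectory φ G p K δ γ t₀ β β' ε ε' z v a μ m)
    (hmin : ∀ w, φ w = 0 → ‖p‖ ≤ ‖w‖) (hφ : Tendsto (fun t => φ (z t)) atTop (𝓝 0))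
    {l : Filter ℝ} (hl : l ≤ atTop) (hin : ∀ᶠ t in l, ‖z t‖ ≤ ‖p‖) :
    Tendsto z l (𝓝 p) :=
  tendsto_of_convex_of_norm_le h.convexOn
    (continuous_iff_continuousAt.2 fun w => (h.hasGradientAt w).continuousAt) h.nonneg
    h.apply_eq_zero hmin (hφ.mono_left hl) fun η hη => by
      filter_upwards [hin] with t ht
      have := pow_le_pow_left₀ (norm_nonneg _) ht 2
      linarith

theorem tendsto_of_le_norm (h : IsTikhonovTrajectory φ G p K δ γ t₀ β β' ε ε' z v a μ m)
    (hmin : ∀ w, φ w = 0 → ‖p‖ ≤ ‖w‖) (hφ : Tendsto (fun t => φ (z t)) atTop (𝓝 0))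
    (hβε : Tendsto (fun t => β t * ε t) atTop atTop)
    (hout : ∀ᶠ t in atTop, ‖p‖ ≤ ‖z t‖) :
    Tendsto z atTop (𝓝 p) := by
  obtain ⟨T, hT⟩ := eventually_atTop.1 (hout.and (eventually_gt_atTop t₀))
  obtain ⟨C, hC, hbd⟩ := h.exists_bound_of_norm_le (hT T le_rfl).2 fun t ht => (hT t ht).1
  refine tendsto_of_convex_of_norm_le h.convexOn
    (continuous_iff_continuousAt.2 fun w => (h.hasGradientAt w).continuousAt) h.nonneg
    h.apply_eq_zero hmin hφ fun η hη => ?_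
  -- Positivity of `β ε` is required separately, because `2 * C / η` vanishes when `C = 0`.
  filter_upwards [eventually_ge_atTop T, hβε.eventually_ge_atTop (2 * C / η),
    hβε.eventually_gt_atTop 0] with t ht h1 h2
  rw [div_le_iff₀ hη] at h1
  have h3 := hbd t ht
  have h4 : 0 ≤ β t * φ (z t) := mul_nonneg (h.beta_pos t (hT t ht).2).le (h.nonneg _)
  have h5 : β t * ε t * (‖z t‖ ^ 2 - ‖p‖ ^ 2) ≤ β t * ε t * η := by linarith
  linarith [le_of_mul_le_mul_left h5 h2]

end IsTikhonovTrajectory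

end Dynamics

/-! ### Reduction of the separable problem to the abstract dynamics -/

namespace SepProblem

variable {X Y Z : Type*}
  [NormedAddCommGroup X] [InnerProductSpace ℝ X]
  [NormedAddCommGroup Y] [InnerProductSpace ℝ Y]
  [NormedAddCommGroup Z] [InnerProductSpace ℝ Z]

/-- The constraint operator `(x, y) ↦ A x + B y` on the Hilbert product. -/
noncomputable def constraintMap (P : SepProblem X Y Z) : WithLp 2 (X × Y) →L[ℝ] Z :=
  P.A ∘L WithLp.fstL 2 ℝ X Y + P.B ∘L WithLp.sndL 2 ℝ X Y

theorem constraintMap_apply (P : SepProblem X Y Z) (w : WithLp 2 (X × Y)) :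
    P.constraintMap w = P.A w.fst + P.B w.snd := rfl

theorem residual_eq (P : SepProblem X Y Z) (w : WithLp 2 (X × Y)) :
    P.residual w.fst w.snd = P.constraintMap w - P.b := rfl

/-- The augmented Lagrangian at the multiplier `l`, minus the objective value at `p`. -/
noncomputable def augmentedGap (P : SepProblem X Y Z) (p : WithLp 2 (X × Y)) (l : Z)
    (w : WithLp 2 (X × Y)) : ℝ :=
  P.lagrangian w.fst w.snd l + 1 / 2 * ‖P.residual w.fst w.snd‖ ^ 2 - P.objective p.fst p.snd

theorem IsSaddlePoint.residual_eq_zero {P : SepProblem X Y Z} {x : X} {y : Y} {l : Z}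
    (h : P.IsSaddlePoint x y l) : P.residual x y = 0 := by
  -- Shifting the multiplier along the residual raises the Lagrangian by the squared norm of the
  -- residual.
  have h1 := (h x y (l + P.residual x y)).1
  simp only [lagrangian, inner_add_left, real_inner_self_eq_norm_sq] at h1
  have h2 : ‖P.residual x y‖ ^ 2 = 0 := le_antisymm (by linarith) (sq_nonneg _)
  simpa using h2

theorem IsSaddlePoint.objective_le_lagrangian {P : SepProblem X Y Z} {x : X} {y : Y} {l : Z}
    (h : P.IsSaddlePoint x y l) {p : WithLp 2 (X × Y)} (hp : p ∈ P.solutionSet) (x' : X)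
    (y' : Y) : P.objective p.fst p.snd ≤ P.lagrangian x' y' l := by
  refine (hp.2 x y h.residual_eq_zero).trans (le_trans (le_of_eq ?_) (h x' y' l).2)
  simp [lagrangian, objective, h.residual_eq_zero]

theorem IsSaddlePoint.augmentedGap_nonneg {P : SepProblem X Y Z} {x : X} {y : Y} {l : Z}
    (h : P.IsSaddlePoint x y l) {p : WithLp 2 (X × Y)} (hp : p ∈ P.solutionSet)
    (w : WithLp 2 (X × Y)) : 0 ≤ P.augmentedGap p l w := by
  have h1 := h.objective_le_lagrangian hp w.fst w.snd
  have h2 := sq_nonneg ‖P.residual w.fst w.snd‖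
  rw [augmentedGap]
  linarith

theorem augmentedGap_self {P : SepProblem X Y Z} (l : Z) {p : WithLp 2 (X × Y)}
    (hp : p ∈ P.solutionSet) : P.augmentedGap p l p = 0 := by
  simp [augmentedGap, lagrangian, objective, hp.1]

/-- The gap is a sum of two nonnegative terms, so both vanish; the quadratic one forces feasibility.
-/
theorem IsSaddlePoint.mem_solutionSet_of_augmentedGap_eq_zero {P : SepProblem X Y Z} {x : X}
    {y : Y} {l : Z} (h : P.IsSaddlePoint x y l) {p : WithLp 2 (X × Y)} (hp : p ∈ P.solutionSet)
    {w : WithLp 2 (X × Y)} (hw : P.augmentedGap p l w = 0) : w ∈ P.solutionSet := by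
  have h1 := h.objective_le_lagrangian hp w.fst w.snd
  have h2 := sq_nonneg ‖P.residual w.fst w.snd‖
  rw [augmentedGap] at hw
  have h3 : ‖P.residual w.fst w.snd‖ ^ 2 = 0 := by linarith
  have h4 : P.residual w.fst w.snd = 0 := by simpa using h3
  refine ⟨h4, fun x' y' hr => le_trans (le_of_eq ?_) (hp.2 x' y' hr)⟩
  simp only [h4, lagrangian, inner_zero_right, norm_zero] at hw
  rw [objective]
  linarith

theorem convexOn_augmentedGap {P : SepProblem X Y Z} (hf : ConvexOn ℝ Set.univ P.f)
    (hg : ConvexOn ℝ Set.univ P.g) (p : WithLp 2 (X × Y)) (l : Z) :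
    ConvexOn ℝ Set.univ (P.augmentedGap p l) := by
  have h1 : ConvexOn ℝ Set.univ fun w : WithLp 2 (X × Y) => P.f w.fst := by
    simpa [Function.comp_def] using hf.comp_linearMap (WithLp.fstL 2 ℝ X Y).toLinearMap
  have h2 : ConvexOn ℝ Set.univ fun w : WithLp 2 (X × Y) => P.g w.snd := by
    simpa [Function.comp_def] using hg.comp_linearMap (WithLp.sndL 2 ℝ X Y).toLinearMap
  have hr : ∀ (w v : WithLp 2 (X × Y)) (a b : ℝ), a + b = 1 →
      P.residual (a • w + b • v).fst (a • w + b • v).snd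
        = a • P.residual w.fst w.snd + b • P.residual v.fst v.snd := by
    intro w v a b hab
    simp only [residual_eq, map_add, map_smul, smul_sub]
    nth_rw 1 [← one_smul ℝ P.b, ← hab, add_smul]
    abel
  have h3 : ConvexOn ℝ Set.univ fun w : WithLp 2 (X × Y) =>
      inner ℝ l (P.residual w.fst w.snd) := by
    refine ⟨convex_univ, fun w _ v _ a b _ _ hab => le_of_eq ?_⟩
    simp only [hr w v a b hab, inner_add_right, inner_smul_right, smul_eq_mul]
  have h4 : ConvexOn ℝ Set.univ fun w : WithLp 2 (X × Y) =>
      ‖P.residual w.fst w.snd‖ ^ 2 := by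
    refine ConvexOn.pow ⟨convex_univ, fun w _ v _ a b ha hb hab => ?_⟩
      (fun w _ => norm_nonneg _) 2
    simp only [hr w v a b hab, smul_eq_mul]
    refine (norm_add_le _ _).trans (le_of_eq ?_)
    rw [norm_smul, norm_smul, Real.norm_of_nonneg ha, Real.norm_of_nonneg hb]
  have h5 := (((h1.add h2).add h3).add (h4.smul (show (0 : ℝ) ≤ 1 / 2 by norm_num))).add
    (convexOn_const (-P.objective p.fst p.snd) convex_univ)
  exact h5

theorem hasDerivAt_toLp {x : ℝ → X} {y : ℝ → Y} {x' : X} {y' : Y} {t : ℝ}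
    (hx : HasDerivAt x x' t) (hy : HasDerivAt y y' t) :
    HasDerivAt (fun s => WithLp.toLp 2 (x s, y s)) (WithLp.toLp 2 (x', y')) t :=
  (WithLp.prodContinuousLinearEquiv 2 ℝ X Y).symm.toContinuousLinearMap.hasFDerivAt.comp_hasDerivAt
    t (hx.prodMk hy)

variable [CompleteSpace X] [CompleteSpace Y] [CompleteSpace Z]

theorem adjoint_constraintMap (P : SepProblem X Y Z) (l : Z) :
    P.constraintMap.adjoint l = WithLp.toLp 2 (P.A.adjoint l, P.B.adjoint l) := by
  refine ext_inner_right ℝ fun w => ?_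
  rw [ContinuousLinearMap.adjoint_inner_left, WithLp.prod_inner_apply, constraintMap_apply,
    inner_add_right, ← ContinuousLinearMap.adjoint_inner_left,
    ← ContinuousLinearMap.adjoint_inner_left]
  rfl

/-- The gradient of the augmented Lagrangian with respect to the primal variables. -/
noncomputable def augmentedGradient (P : SepProblem X Y Z) (l : Z) (w : WithLp 2 (X × Y)) :
    WithLp 2 (X × Y) :=
  WithLp.toLp 2 (gradient P.f w.fst, gradient P.g w.snd) + P.constraintMap.adjoint l
    + P.constraintMap.adjoint (P.residual w.fst w.snd)

theorem hasGradientAt_augmentedGap {P : SepProblem X Y Z} (hf : Differentiable ℝ P.f)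
    (hg : Differentiable ℝ P.g) (p : WithLp 2 (X × Y)) (l : Z) (w : WithLp 2 (X × Y)) :
    HasGradientAt (P.augmentedGap p l) (P.augmentedGradient l w) w := by
  rw [hasGradientAt_iff_hasFDerivAt]
  have h1 : HasFDerivAt (fun w : WithLp 2 (X × Y) => P.f w.fst) _ w :=
    (hf w.fst).hasGradientAt.hasFDerivAt.comp w (WithLp.fstL 2 ℝ X Y).hasFDerivAt
  have h2 : HasFDerivAt (fun w : WithLp 2 (X × Y) => P.g w.snd) _ w :=
    (hg w.snd).hasGradientAt.hasFDerivAt.comp w (WithLp.sndL 2 ℝ X Y).hasFDerivAt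
  have h3 : HasFDerivAt (fun w : WithLp 2 (X × Y) => P.residual w.fst w.snd)
      P.constraintMap w := P.constraintMap.hasFDerivAt.sub_const P.b
  have h4 := (innerSL ℝ l).hasFDerivAt.comp w h3
  have h5 := ((((h1.add h2).add h4).add (h3.norm_sq.const_mul (1 / 2))).sub_const
    (P.objective p.fst p.snd))
  refine h5.congr_fderiv ?_
  ext v
  simp [augmentedGradient, ContinuousLinearMap.adjoint_inner_left,
    WithLp.prod_inner_apply]

/-- Solutions of the primal-dual system, centered at a primal-dual optimal pair. -/
theorem IsSolution.exists_isTikhonovTrajectory {P : SepProblem X Y Z}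
    (hf : ContDiff ℝ 1 P.f) (hfconv : ConvexOn ℝ Set.univ P.f)
    (hg : ContDiff ℝ 1 P.g) (hgconv : ConvexOn ℝ Set.univ P.g)
    {xs : X} {ys : Y} {ls : Z} (hsaddle : P.IsSaddlePoint xs ys ls)
    {γ δ t₀ : ℝ} (hδ : 0 < δ) {β ε : ℝ → ℝ}
    (hβpos : ∀ t ∈ Set.Ici t₀, 0 < β t) (hβmono : MonotoneOn β (Set.Ici t₀))
    (hβdiff : DifferentiableOn ℝ β (Set.Ici t₀))
    (hεnonneg : ∀ t ∈ Set.Ici t₀, 0 ≤ ε t) (hεanti : AntitoneOn ε (Set.Ici t₀))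
    (hεdiff : DifferentiableOn ℝ ε (Set.Ici t₀))
    (hβderiv : ∀ t ∈ Set.Ici t₀, derivWithin β (Set.Ici t₀) t ≤ 1 / δ * β t) (hγ : 1 / δ < γ)
    {p : WithLp 2 (X × Y)} (hp : p ∈ P.solutionSet)
    {x : ℝ → X} {y : ℝ → Y} {l : ℝ → Z} (hsol : P.IsSolution γ δ t₀ β ε x y l) :
    ∃ (v a : ℝ → WithLp 2 (X × Y)) (m : ℝ → Z),
      IsTikhonovTrajectory (P.augmentedGap p ls) (P.augmentedGradient ls) p P.constraintMap δ γ
        t₀ β (derivWithin β (Set.Ici t₀)) ε (derivWithin ε (Set.Ici t₀))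
        (fun t => WithLp.toLp 2 (x t, y t)) v a (fun t => l t - ls) m := by
  obtain ⟨x', x'', y', y'', l', h⟩ := hsol
  -- Away from `t₀` the one-sided derivatives are two-sided.
  have hnhds : ∀ {t : ℝ}, t₀ < t → Set.Ici t₀ ∈ 𝓝 t := fun ht => Ici_mem_nhds ht
  have hmem : ∀ {t : ℝ}, t₀ < t → t ∈ Set.Ici t₀ := fun ht => le_of_lt ht
  refine ⟨fun t => WithLp.toLp 2 (x' t, y' t), fun t => WithLp.toLp 2 (x'' t, y'' t), l',
    convexOn_augmentedGap hfconv hgconv p ls, hsaddle.augmentedGap_nonneg hp,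
    augmentedGap_self ls hp, hasGradientAt_augmentedGap (hf.differentiable one_ne_zero)
      (hg.differentiable one_ne_zero) p ls, hδ, hγ, fun t ht => hβpos t (hmem ht),
    hβmono.mono Set.Ioi_subset_Ici_self,
    fun t ht => (hβdiff t (hmem ht)).hasDerivWithinAt.hasDerivAt (hnhds ht),
    fun t ht => hβderiv t (hmem ht),
    fun t ht => hεnonneg t (hmem ht),
    fun t ht => (hεdiff t (hmem ht)).hasDerivWithinAt.hasDerivAt (hnhds ht),
    fun t _ => hεanti.derivWithin_nonpos, fun t ht => ?_, fun t ht => ?_, fun t ht => ?_,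
    fun t ht => ?_, fun t ht => ?_⟩ <;>
  obtain ⟨h1, h2, h3, h4, h5, h6, h7, h8⟩ := h t (hmem ht)
  · exact hasDerivAt_toLp (h1.hasDerivAt (hnhds ht)) (h3.hasDerivAt (hnhds ht))
  · exact hasDerivAt_toLp (h2.hasDerivAt (hnhds ht)) (h4.hasDerivAt (hnhds ht))
  · exact (h5.hasDerivAt (hnhds ht)).sub_const ls
  · have hz : WithLp.toLp 2 (x'' t + γ • x' t + β t • (gradient P.f (x t) + P.A.adjoint (l t)
        + P.A.adjoint (P.residual (x t) (y t)) + ε t • x t),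
        y'' t + γ • y' t + β t • (gradient P.g (y t) + P.B.adjoint (l t)
        + P.B.adjoint (P.residual (x t) (y t)) + ε t • y t)) = 0 := by
      rw [h6, h7]; rfl
    rw [← hz]
    -- The `ls` part of the multiplier is already in the gradient of the gap.
    have hcancel : P.augmentedGradient ls (WithLp.toLp 2 (x t, y t))
        + P.constraintMap.adjoint (l t - ls)
        = WithLp.toLp 2 (gradient P.f (x t), gradient P.g (y t)) + P.constraintMap.adjoint (l t)
          + P.constraintMap.adjoint (P.residual (x t) (y t)) := by
      rw [augmentedGradient, map_sub]
      simp only [WithLp.toLp_fst, WithLp.toLp_snd]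
      abel
    rw [hcancel, adjoint_constraintMap, adjoint_constraintMap]
    rfl
  -- Feasibility `K p = b` turns the residual at `z + δ v` into `K (z - p + δ v)`.
  · have hr := hp.1
    rw [residual_eq, sub_eq_zero] at hr
    rw [sub_eq_zero.1 h8]
    congr 1
    rw [map_add, map_sub, hr, map_smul]
    simp only [residual, constraintMap_apply, WithLp.toLp_fst, WithLp.toLp_snd, map_add, map_smul,
      smul_add]
    abel

end SepProblem

/-! ### The primitive of `ε` and the conclusion -/

theorem tendsto_primitive_of_integrableOn {ε : ℝ → ℝ} {t₀ : ℝ}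
    (hε : ContinuousOn ε (Set.Ici t₀)) (hint : MeasureTheory.IntegrableOn ε (Set.Ici t₀)) :
    ∃ (J : ℝ → ℝ) (j : ℝ), (∀ t > t₀, HasDerivAt J (ε t) t) ∧ Tendsto J atTop (𝓝 j) := by
  refine ⟨fun t => ∫ s in t₀..t, ε s, _, fun t ht => ?_,
    MeasureTheory.intervalIntegral_tendsto_integral_Ioi t₀
      (hint.mono_set Set.Ioi_subset_Ici_self) tendsto_id⟩
  refine intervalIntegral.integral_hasDerivAt_right ?_ ?_ (hε.continuousAt (Ici_mem_nhds ht))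
  · exact (hε.mono fun s hs => by
      rw [Set.uIcc_of_le (le_of_lt ht)] at hs; exact hs.1).intervalIntegrable
  · exact (hε.mono Set.Ioi_subset_Ici_self).stronglyMeasurableAtFilter isOpen_Ioi t ht

theorem theorem4p2
    {X Y Z : Type*}
    [NormedAddCommGroup X] [InnerProductSpace ℝ X] [CompleteSpace X]
    [NormedAddCommGroup Y] [InnerProductSpace ℝ Y] [CompleteSpace Y]
    [NormedAddCommGroup Z] [InnerProductSpace ℝ Z] [CompleteSpace Z]
    (P : SepProblem X Y Z)
    (hf : ContDiff ℝ 1 P.f) (hfconv : ConvexOn ℝ Set.univ P.f)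
    (hflip : ∃ K : NNReal, LipschitzWith K (gradient P.f))
    (hg : ContDiff ℝ 1 P.g) (hgconv : ConvexOn ℝ Set.univ P.g)
    (hglip : ∃ K : NNReal, LipschitzWith K (gradient P.g))
    (hsaddle : ∃ (xs : X) (ys : Y) (ls : Z), P.IsSaddlePoint xs ys ls)
    (γ δ t₀ : ℝ) (ht₀ : 0 < t₀) (hδ : 0 < δ)
    (β ε : ℝ → ℝ)
    (hβpos : ∀ t ∈ Set.Ici t₀, 0 < β t)
    (hβmono : MonotoneOn β (Set.Ici t₀))
    (hβdiff : ContDiffOn ℝ 1 β (Set.Ici t₀))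
    (hεnonneg : ∀ t ∈ Set.Ici t₀, 0 ≤ ε t)
    (hεanti : AntitoneOn ε (Set.Ici t₀))
    (hεdiff : ContDiffOn ℝ 1 ε (Set.Ici t₀))
    (hεlim : Tendsto ε atTop (𝓝 0))
    (hεint : MeasureTheory.IntegrableOn ε (Set.Ici t₀))
    (hβε : Tendsto (fun t => β t * ε t) atTop atTop)
    (hβderiv : ∀ t ∈ Set.Ici t₀, derivWithin β (Set.Ici t₀) t ≤ 1 / δ * β t)
    (hγ : 1 / δ < γ)
    (zbar : WithLp 2 (X × Y)) (hzbar : IsProjOnto P.solutionSet 0 zbar)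
    (x : ℝ → X) (y : ℝ → Y) (l : ℝ → Z)
    (hsol : P.IsSolution γ δ t₀ β ε x y l) :
    liminf (fun t => ((‖WithLp.toLp 2 (x t, y t) - zbar‖ : ℝ) : EReal)) atTop = 0 ∧
    ((∃ T ≥ t₀,
        (∀ t ≥ T, WithLp.toLp 2 (x t, y t) ∈ Metric.closedBall 0 ‖zbar‖) ∨
        (∀ t ≥ T, WithLp.toLp 2 (x t, y t) ∈ (Metric.closedBall 0 ‖zbar‖)ᶜ)) →
      Tendsto (fun t => ‖WithLp.toLp 2 (x t, y t) - zbar‖) atTop (𝓝 0)) := by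

  obtain ⟨xs, ys, ls, hs⟩ := hsaddle
  obtain ⟨v, a, m, h⟩ := hsol.exists_isTikhonovTrajectory hf hfconv hg hgconv hs hδ hβpos hβmono
    (hβdiff.differentiableOn one_ne_zero) hεnonneg hεanti (hεdiff.differentiableOn one_ne_zero)
    hβderiv hγ hzbar.1
  obtain ⟨J, j, hJ, hj⟩ := tendsto_primitive_of_integrableOn hεdiff.continuousOn hεint
  have hmin : ∀ w, P.augmentedGap zbar ls w = 0 → ‖zbar‖ ≤ ‖w‖ := fun w hw => by
    simpa using hzbar.2 w (hs.mem_solutionSet_of_augmentedGap_eq_zero hzbar.1 hw)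
  have hβ : Tendsto β atTop atTop := by
    -- Once `ε ≤ 1`, `β` dominates `β ε`.
    refine tendsto_atTop_mono' atTop ?_ hβε
    filter_upwards [hεlim.eventually_le_const one_pos, eventually_ge_atTop t₀] with t h1 h2
    exact mul_le_of_le_one_right (hβpos t h2).le h1
  have hφ := h.tendsto_apply hJ hj hβ
  have houtside : (∀ᶠ t in atTop, ‖zbar‖ < ‖WithLp.toLp 2 (x t, y t)‖) →
      Tendsto (fun t => ‖WithLp.toLp 2 (x t, y t) - zbar‖) atTop (𝓝 0) := fun ho =>
    tendsto_iff_norm_sub_tendsto_zero.1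
      (h.tendsto_of_le_norm hmin hφ hβε (ho.mono fun _ ht => ht.le))
  refine ⟨?_, ?_⟩
  -- Convergence along any nontrivial filter finer than `atTop` bounds the liminf from above; `k` is
  -- either `atTop` restricted to the times in the ball, or `atTop` itself.
  · have hkey : ∃ k : Filter ℝ, k.NeBot ∧ k ≤ atTop ∧
        Tendsto (fun t => ‖WithLp.toLp 2 (x t, y t) - zbar‖) k (𝓝 0) := by
      by_cases hin : ∃ᶠ t in atTop, ‖WithLp.toLp 2 (x t, y t)‖ ≤ ‖zbar‖
      · exact ⟨_, frequently_mem_iff_neBot.1 hin, inf_le_left,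
          tendsto_iff_norm_sub_tendsto_zero.1 (h.tendsto_of_norm_le hmin hφ inf_le_left
            (mem_inf_of_right (mem_principal_self _)))⟩
      · exact ⟨atTop, inferInstance, le_rfl, houtside (by simpa using hin)⟩
    obtain ⟨k, hk, hle, hlim⟩ := hkey
    have hlim' : Tendsto (fun t => ((‖WithLp.toLp 2 (x t, y t) - zbar‖ : ℝ) : EReal)) k
        (𝓝 ((0 : ℝ) : EReal)) := (continuous_coe_real_ereal.tendsto 0).comp hlim
    refine le_antisymm ((liminf_le_liminf_of_le hle).trans hlim'.liminf_eq.le) ?_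
    exact le_liminf_of_le (by isBoundedDefault)
      (Eventually.of_forall fun t => EReal.coe_nonneg.2 (norm_nonneg _))
  · rintro ⟨T, -, hin | hout⟩
    · refine tendsto_iff_norm_sub_tendsto_zero.1 (h.tendsto_of_norm_le hmin hφ le_rfl ?_)
      filter_upwards [eventually_ge_atTop T] with t ht
      simpa using hin t ht
    · refine houtside ?_
      filter_upwards [eventually_ge_atTop T] with t ht
      simpa using hout t ht
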